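/- Let $(X,\rho)$ be a compact metric space and $T\colon X\to X$ continuous. Let $X^\infty$ be the set of sequences $\underline x=(x_j)_{j\ge 0}$ in $X$, and for $x\in X$ let $\underline x_T=(T^j x)_{j\ge0}$ be its trajectory. For $\underline x,\underline z\in X^\infty$, $n\in\mathbb N$ and $\delta>0$, an $(n,\delta)$-match is an order preserving bijection $\pi\colon \mathcal D(\pi)\to\mathcal R(\pi)$ between subsets of $\{0,\dots,n-1\}$ with $\rho(x_i,z_{\pi(i)})<\delta$ for all $i\in\mathcal D(\pi)$. Put $$\bar f_{n,\delta}(\underline x,\underline z)=1-\frac1n\max\{|\mathcal D(\pi)| : \pi \text{ is an } (n,\delta)\text{-match of } \underline x \text{ and } \underline z\},\qquad \bar f_\delta(\underline x,\underline z)=\limsup_{n\to\infty}\bar f_{n,\delta}(\underline x,\underline z),$$ $$\bar F_K(\underline x,\underline z)=\inf\{\delta>0:\bar f_\delta(\underline x,\underline z)<\delta\}.$$ A Borel probability measure $\mu$ on $X$ is generated by $\underline x\in X^\infty$ if it is the weak$^*$ limit of a subsequence of the empirical measures $\frac1n\sum_{j=0}^{n-1}\delta_{x_j}$, $n\ge 1$;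 $\underline x$ is generic for $\mu$ if $\mu$ is the only measure generated by $\underline x$. A point $x\in X$ is ergodic if $\underline x_T$ is generic for some $T$-invariant ergodic measure. A sequence $\underline z\in X^\infty$ is a quasi-orbit if the set $\{n\ge 0: z_{n+1}\ne T(z_n)\}$ has upper density $0$. **Theorem.** Let $(x^{(p)})_{p\ge1}$ be a sequence of ergodic points of $X$ which is $\bar F_K$-Cauchy, that is, for every $\varepsilon>0$ there is $N$ with $\bar F_K(\underline x^{(k)}_T,\underline x^{(\ell)}_T)<\varepsilon$ for all $k,\ell\ge N$, and let $\mu_p$ be the measure for which $\underline x^{(p)}_T$ is generic. Then there is a $T$-invariant ergodic Borel probability measure $\mu$ on $X$ such that 1. $\mu_p\to\mu$ in the weak$^*$ topology; 2. there is a quasi-orbit $\underline z\in X^\infty$, generic for $\mu$, with $\bar F_K(\underline x^{(p)}_T,\underline z)\to0$ as $p\to\infty$; 3. every $\underline z\in X^\infty$ with $\bar F_K(\underline x^{(p)}_T,\underline z)\to0$ as $p\to\infty$ is generic for $\mu$ (so $\mu$ is uniquely determined by the sequence). -/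

import Mathlib

open Filter Topology MeasureTheory

namespace FeldmanKatok

noncomputable section

/-- The upper density of a set of nonnegative integers. -/
def upperDensity (A : Set ℕ) : ℝ :=
  limsup (fun n : ℕ => ((A ∩ Set.Iio n).ncard : ℝ) / (n : ℝ)) atTop

/-- The trajectory `(T^j x)_{j ≥ 0}` of a point `x`. -/
def trajectory {X : Type*} (T : X → X) (x : X) : ℕ → X := fun j => T^[j] x

/-- A quasi-orbit: the positions at which the sequence fails to follow `T` have
upper density zero. -/
def IsQuasiOrbit {X : Type*} (T : X → X) (z : ℕ → X) : Prop :=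
  upperDensity {n : ℕ | z (n + 1) ≠ T (z n)} = 0

/-- An `(n, δ)`-match of `x` and `z`: an order preserving bijection between two subsets
of `{0, …, n - 1}` that pairs indices of `δ`-close entries. -/
structure Match {X : Type*} [MetricSpace X] (x z : ℕ → X) (n : ℕ) (δ : ℝ) where
  /-- the domain of the match -/
  dom : Finset ℕ
  /-- the range of the match -/
  ran : Finset ℕ
  /-- the order preserving bijection -/
  toIso : dom ≃o ran
  dom_subset : dom ⊆ Finset.range n
  ran_subset : ran ⊆ Finset.range n
  close : ∀ i : dom, dist (x i) (z (toIso i)) < δ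

/-- The fit of a match is the cardinality of its domain. -/
def Match.fit {X : Type*} [MetricSpace X] {x z : ℕ → X} {n : ℕ} {δ : ℝ}
    (π : Match x z n δ) : ℕ := π.dom.card

/-- The largest fit of an `(n, δ)`-match of `x` and `z`. -/
def maxFit {X : Type*} [MetricSpace X] (x z : ℕ → X) (n : ℕ) (δ : ℝ) : ℕ :=
  sSup (Set.range fun π : Match x z n δ => π.fit)

/-- The supremum defining `maxFit` is a maximum: it is attained and is an upper bound. -/
theorem isGreatest_maxFit {X : Type*} [MetricSpace X] (x z : ℕ → X) (n : ℕ) (δ : ℝ) :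
    IsGreatest (Set.range fun π : Match x z n δ => π.fit) (maxFit x z n δ) := by
  have hne : (Set.range fun π : Match x z n δ => π.fit).Nonempty :=
    ⟨_, ⟨⟨∅, ∅, OrderIso.refl _, by simp, by simp, fun i => absurd i.2 (Finset.notMem_empty _)⟩, rfl⟩⟩
  have hb : BddAbove (Set.range fun π : Match x z n δ => π.fit) := by
    refine ⟨n, ?_⟩
    rintro _ ⟨π, rfl⟩
    simpa [Match.fit] using Finset.card_le_card π.dom_subset
  exact ⟨Nat.sSup_mem hne hb, fun k hk => le_csSup hb hk⟩

/-- The `(n, δ)`-gap between `x` and `z`. -/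
def gap {X : Type*} [MetricSpace X] (n : ℕ) (δ : ℝ) (x z : ℕ → X) : ℝ :=
  1 - (maxFit x z n δ : ℝ) / (n : ℝ)

/-- The pseudodistance `f̄_δ`. -/
def fbar {X : Type*} [MetricSpace X] (δ : ℝ) (x z : ℕ → X) : ℝ :=
  limsup (fun n : ℕ => gap n δ x z) atTop

/-- The Feldman-Katok pseudometric on sequences. -/
def FK {X : Type*} [MetricSpace X] (x z : ℕ → X) : ℝ :=
  sInf {δ : ℝ | 0 < δ ∧ fbar δ x z < δ}

/-- A sequence of elements of `X^∞` is Cauchy for the Feldman-Katok pseudometric. -/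
def IsFKCauchy {X : Type*} [MetricSpace X] (x : ℕ → ℕ → X) : Prop :=
  ∀ ε : ℝ, 0 < ε → ∃ N : ℕ, ∀ k l : ℕ, N ≤ k → N ≤ l → FK (x k) (x l) < ε

/-- `z` is a limit of the sequence `x` of elements of `X^∞` for the Feldman-Katok
pseudometric. -/
def IsFKLimit {X : Type*} [MetricSpace X] (x : ℕ → ℕ → X) (z : ℕ → X) : Prop :=
  Tendsto (fun p : ℕ => FK (x p) z) atTop (𝓝 0)

/-- The `n`-empirical measure `(1 / n) ∑_{j < n} δ_{x_j}` of a sequence, for `n ≥ 1`. -/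
def empirical {X : Type*} [MeasurableSpace X] (x : ℕ → X) (n : ℕ+) : ProbabilityMeasure X :=
  ⟨((n : ℕ) : ENNReal)⁻¹ • ∑ j ∈ Finset.range n, Measure.dirac (x j), ⟨by
    simp [Measure.smul_apply, ENNReal.inv_mul_cancel]⟩⟩

/-- The set of measures generated by `x`: the weak-* limits of subsequences of the sequence
of empirical measures. -/
def generated {X : Type*} [MetricSpace X] [MeasurableSpace X] [BorelSpace X]
    (x : ℕ → X) : Set (ProbabilityMeasure X) :=
  {μ | ∃ φ : ℕ → ℕ+, StrictMono φ ∧ Tendsto (fun i => empirical x (φ i)) atTop (𝓝 μ)}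

/-- `x` is a generic sequence for `μ`. -/
def IsGeneric {X : Type*} [MetricSpace X] [MeasurableSpace X] [BorelSpace X]
    (x : ℕ → X) (μ : ProbabilityMeasure X) : Prop :=
  generated x = {μ}

/-- `x` is an ergodic point: its trajectory is generic for some `T`-invariant ergodic
measure. -/
def IsErgodicPoint {X : Type*} [MetricSpace X] [MeasurableSpace X] [BorelSpace X]
    (T : X → X) (x : X) : Prop :=
  ∃ μ : ProbabilityMeasure X, Ergodic T (μ : Measure X) ∧ IsGeneric (trajectory T x) μ

end

end FeldmanKatok

/-!
Everything rests on comparing averages along two sequences `x`, `z` with `FK x z` small. A match of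
fit close to `n` pairs most of the terms `f (x i)`, `i < n`, with nearby terms `f (z (σ i))`, so
that the averages of a continuous `f` along `x` and `z` are close. Hence the measures `ν p`
generated by a Cauchy sequence converge to some `μ`, and every Feldman-Katok limit of the sequence
is generic for `μ` (`exists_tendsto_of_isFKCauchy`, `IsFKLimit.isGeneric`).

Ergodicity uses that matches preserve the order. If `i` is matched with `σ i`, then all but few
positions of the window `[i, i + k)` are matched into `[σ i, σ i + k)`: the exceptions are bounded
by the numbers of unmatched positions in the two windows (`le_card_window`), and on average over
`i` these are at most `k` times the gap, up to an error that vanishes as `n → ∞`. So if `A_k f` is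
the Birkhoff average of length `k`, the integrals `∫ |A_k f - c|` for `ν p` and `ν q` are close
*uniformly in `k`* (`exists_forall_FK_lt_integral`). By the mean ergodic theorem for a single
`ν p`, some such integral is small; it stays small for all later `q`, and in the limit for `μ`. An
invariant measure for which Birkhoff averages of continuous functions come close to constants in
mean is ergodic (`ergodic_of_forall_exists_integral_abs_le`).

The quasi-orbit follows the trajectory of `x j` on the block `[s j, s (j + 1))`, where `s` grows
fast. Below `n` it is matched with the `p`-th trajectory by concatenating matches on the last two
blocks, and everything before them is negligible (`maxFit_add_le`, `exists_isFKLimit_blocks`). It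
can fail to follow `T` only where a block ends, which happens at most `√n` times below `n`
(`isQuasiOrbit_blocks`).
-/

namespace FeldmanKatok

/-! ### Matches as increasing functions -/

section Combinatorics

variable {X : Type*} [MetricSpace X] {x z w : ℕ → X} {n m : ℕ} {δ : ℝ}

/-- The function `σ`, restricted to `D`, is an `(n, δ)`-match of `x` and `z`. Values of `σ`
outside `D` are irrelevant. -/
structure IsMatchOn (x z : ℕ → X) (n : ℕ) (δ : ℝ) (D : Finset ℕ) (σ : ℕ → ℕ) : Prop where
  lt_dom : ∀ i ∈ D, i < n
  lt_ran : ∀ i ∈ D, σ i < n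
  mono : StrictMonoOn σ D
  close : ∀ i ∈ D, dist (x i) (z (σ i)) < δ

theorem IsMatchOn.card_le_maxFit {D : Finset ℕ} {σ : ℕ → ℕ} (h : IsMatchOn x z n δ D σ) :
    D.card ≤ maxFit x z n δ := by
  have hmem : ∀ i : D, σ i ∈ D.image σ := fun i => Finset.mem_image_of_mem σ i.2
  have hmono : StrictMono (fun i : D => (⟨σ i, hmem i⟩ : {j // j ∈ D.image σ})) :=
    fun i j hij => h.mono i.2 j.2 hij
  have hsurj : Function.Surjective (fun i : D => (⟨σ i, hmem i⟩ : {j // j ∈ D.image σ})) := by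
    rintro ⟨j, hj⟩
    obtain ⟨i, hi, rfl⟩ := Finset.mem_image.1 hj
    exact ⟨⟨i, hi⟩, rfl⟩
  exact (isGreatest_maxFit x z n δ).2 ⟨⟨D, D.image σ, hmono.orderIsoOfSurjective _ hsurj,
    fun i hi => Finset.mem_range.2 (h.lt_dom i hi),
    fun j hj => by
      obtain ⟨i, hi, rfl⟩ := Finset.mem_image.1 hj
      exact Finset.mem_range.2 (h.lt_ran i hi),
    fun i => h.close i i.2⟩, rfl⟩

theorem exists_isMatchOn (x z : ℕ → X) (n : ℕ) (δ : ℝ) :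
    ∃ D σ, IsMatchOn x z n δ D σ ∧ D.card = maxFit x z n δ := by
  obtain ⟨π, hπ⟩ := (isGreatest_maxFit x z n δ).1
  have key : ∀ i (hi : i ∈ π.dom),
      (if h : i ∈ π.dom then (π.toIso ⟨i, h⟩ : ℕ) else 0) = π.toIso ⟨i, hi⟩ :=
    fun i hi => dif_pos hi
  refine ⟨π.dom, fun i => if h : i ∈ π.dom then (π.toIso ⟨i, h⟩ : ℕ) else 0,
    ⟨fun i hi => Finset.mem_range.1 (π.dom_subset hi), fun i hi => ?_, fun i hi j hj hij => ?_,
      fun i hi => ?_⟩, hπ⟩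
  · simp only [key i hi]
    exact Finset.mem_range.1 (π.ran_subset (π.toIso ⟨i, hi⟩).2)
  · simp only [key i hi, key j hj]
    exact π.toIso.strictMono (show (⟨i, hi⟩ : {i // i ∈ π.dom}) < ⟨j, hj⟩ from hij)
  · simp only [key i hi]
    exact π.close ⟨i, hi⟩

theorem maxFit_le (x z : ℕ → X) (n : ℕ) (δ : ℝ) : maxFit x z n δ ≤ n := by
  obtain ⟨D, σ, h, hD⟩ := exists_isMatchOn x z n δ
  rw [← hD]
  simpa using Finset.card_le_card
    (fun i hi => Finset.mem_range.2 (h.lt_dom i hi) : D ⊆ Finset.range n)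

theorem maxFit_mono {δ' : ℝ} (hδ : δ ≤ δ') : maxFit x z n δ ≤ maxFit x z n δ' := by
  obtain ⟨D, σ, h, hD⟩ := exists_isMatchOn x z n δ
  rw [← hD]
  exact IsMatchOn.card_le_maxFit
    ⟨h.lt_dom, h.lt_ran, h.mono, fun i hi => (h.close i hi).trans_le hδ⟩

/-- Matches can be concatenated: if `z` agrees with `w` on `[m, n)`, then a match of `x` and `z`
below `m` is extended by the part of a match of `x` and `w` that lives on `[m, n) × [m, n)`, and
at most `m` pairs of the latter are lost. -/
theorem maxFit_add_le (hmn : m ≤ n) (hzw : ∀ i, m ≤ i → i < n → z i = w i) :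
    maxFit x z m δ + maxFit x w n δ ≤ maxFit x z n δ + m := by
  obtain ⟨D, σ, h, hD⟩ := exists_isMatchOn x z m δ
  obtain ⟨E, τ, h', hE⟩ := exists_isMatchOn x w n δ
  set E' := E.filter fun i => m ≤ i ∧ m ≤ τ i
  have hlost : (E.filter fun i => ¬ (m ≤ i ∧ m ≤ τ i)).card ≤ m := by
    -- `i ↦ min i (τ i)` is strictly increasing on `E`, so it embeds the lost pairs into `[0, m)`.
    have := Finset.card_le_card_of_injOn (s := E.filter fun i => ¬ (m ≤ i ∧ m ≤ τ i))
      (t := Finset.range m) (fun i => min i (τ i)) (fun i hi => by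
        simp only [Finset.mem_coe, Finset.mem_filter] at hi
        simp only [Finset.coe_range, Set.mem_Iio]
        omega) (by
        have hm : StrictMonoOn (fun i => min i (τ i)) E := fun i hi j hj hij => by
          have := h'.mono hi hj hij
          simp only [lt_min_iff, min_lt_iff]
          omega
        exact hm.injOn.mono (Finset.coe_subset.2 (Finset.filter_subset _ _)))
    simpa using this
  have hcard : E'.card + (E.filter fun i => ¬ (m ≤ i ∧ m ≤ τ i)).card = E.card :=
    Finset.card_filter_add_card_filter_not _
  have hdisj : Disjoint D E' := Finset.disjoint_left.2 fun i hi hi' => by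
    have := h.lt_dom i hi
    have := (Finset.mem_filter.1 hi').2.1
    omega
  have hσ : ∀ i, i < m → (if i < m then σ i else τ i) = σ i := fun i hi => if_pos hi
  have hτ : ∀ i, m ≤ i → (if i < m then σ i else τ i) = τ i := fun i hi => if_neg hi.not_gt
  have hmatch : IsMatchOn x z n δ (D ∪ E') (fun i => if i < m then σ i else τ i) := by
    have hmE : ∀ i ∈ E', i ∈ E ∧ m ≤ i ∧ m ≤ τ i := fun i hi => Finset.mem_filter.1 hi
    refine ⟨fun i hi => ?_, fun i hi => ?_, fun i hi j hj hij => ?_, fun i hi => ?_⟩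
    · rcases Finset.mem_union.1 hi with hi | hi
      · exact (h.lt_dom i hi).trans_le hmn
      · exact h'.lt_dom i (hmE i hi).1
    · rcases Finset.mem_union.1 hi with hi | hi
      · simp only [hσ i (h.lt_dom i hi)]
        exact (h.lt_ran i hi).trans_le hmn
      · simp only [hτ i (hmE i hi).2.1]
        exact h'.lt_ran i (hmE i hi).1
    · rcases Finset.mem_union.1 hi with hi | hi <;> rcases Finset.mem_union.1 hj with hj | hj
      · simp only [hσ i (h.lt_dom i hi), hσ j (h.lt_dom j hj)]
        exact h.mono hi hj hij
      · simp only [hσ i (h.lt_dom i hi), hτ j (hmE j hj).2.1]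
        exact (h.lt_ran i hi).trans_le (hmE j hj).2.2
      · have := h.lt_dom j hj
        have := (hmE i hi).2.1
        omega
      · simp only [hτ i (hmE i hi).2.1, hτ j (hmE j hj).2.1]
        exact h'.mono (hmE i hi).1 (hmE j hj).1 hij
    · rcases Finset.mem_union.1 hi with hi | hi
      · simp only [hσ i (h.lt_dom i hi)]
        exact h.close i hi
      · simp only [hτ i (hmE i hi).2.1]
        rw [hzw _ (hmE i hi).2.2 (h'.lt_ran i (hmE i hi).1)]
        exact h'.close i (hmE i hi).1
  have := hmatch.card_le_maxFit
  rw [Finset.card_union_of_disjoint hdisj] at this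
  omega

theorem gap_nonneg (n : ℕ) (δ : ℝ) (x z : ℕ → X) : 0 ≤ gap n δ x z := by
  have : (maxFit x z n δ : ℝ) / n ≤ 1 :=
    div_le_one_of_le₀ (by exact_mod_cast maxFit_le x z n δ) (by positivity)
  unfold gap
  linarith

theorem gap_le_one (n : ℕ) (δ : ℝ) (x z : ℕ → X) : gap n δ x z ≤ 1 := by
  have : 0 ≤ (maxFit x z n δ : ℝ) / n := by positivity
  unfold gap
  linarith

theorem gap_anti {δ' : ℝ} (hδ : δ ≤ δ') : gap n δ' x z ≤ gap n δ x z := by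
  unfold gap
  have : (maxFit x z n δ : ℝ) / n ≤ maxFit x z n δ' / n := by
    gcongr
    exact maxFit_mono hδ
  linarith

theorem fbar_le {c : ℝ} (h : ∀ᶠ n in atTop, gap n δ x z ≤ c) : fbar δ x z ≤ c :=
  limsup_le_of_le (isCoboundedUnder_le_of_le atTop (fun n => gap_nonneg n δ x z)) h

theorem FK_nonneg (x z : ℕ → X) : 0 ≤ FK x z :=
  Real.sInf_nonneg fun _ h => h.1.le

theorem FK_le {c : ℝ} (hc : 0 < c) (h : fbar c x z < c) : FK x z ≤ c :=
  csInf_le ⟨0, fun _ h => h.1.le⟩ ⟨hc, h⟩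

theorem eventually_gap_lt {c : ℝ} (h : FK x z < c) : ∀ᶠ n in atTop, gap n c x z < c := by
  have hne : {δ : ℝ | 0 < δ ∧ fbar δ x z < δ}.Nonempty :=
    ⟨2, two_pos, (fbar_le (Eventually.of_forall fun n => gap_le_one n 2 x z)).trans_lt one_lt_two⟩
  obtain ⟨δ, ⟨-, hδ⟩, hδc⟩ := exists_lt_of_csInf_lt hne h
  have := eventually_lt_of_limsup_lt hδ
    (isBoundedUnder_of ⟨1, fun n => gap_le_one n δ x z⟩)
  exact this.mono fun n hn => (gap_anti hδc.le).trans_lt (hn.trans hδc)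

/-! ### Averages along matched windows -/

/-- For an increasing function `σ` on `D` and `i ∈ D`, the windows `[i, i + k)` and
`[σ i, σ i + k)` are matched by `σ` up to the positions that are not in `D` or not in `σ(D)`:
both the elements of `D` in the first window and the preimages of the second window are initial
segments of `D ∩ [i, ∞)`, so one contains the other. -/
theorem le_card_window {D : Finset ℕ} {σ : ℕ → ℕ} (hσ : StrictMonoOn σ D) {i : ℕ} (hi : i ∈ D)
    (k : ℕ) :
    k ≤ (D.filter fun d => d ∈ Finset.Ico i (i + k) ∧ σ d ∈ Finset.Ico (σ i) (σ i + k)).card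
      + (Finset.Ico i (i + k) \ D).card + (Finset.Ico (σ i) (σ i + k) \ D.image σ).card := by
  have h1 : (Finset.Ico i (i + k) \ D).card
      + (D.filter fun d => d ∈ Finset.Ico i (i + k)).card = k := by
    have := Finset.card_sdiff_add_card_inter (Finset.Ico i (i + k)) D
    rwa [Nat.card_Ico, Nat.add_sub_cancel_left, Finset.inter_comm,
      ← Finset.filter_mem_eq_inter] at this
  have h2 : (Finset.Ico (σ i) (σ i + k) \ D.image σ).card
      + (D.filter fun d => σ d ∈ Finset.Ico (σ i) (σ i + k)).card = k := by
    have := Finset.card_sdiff_add_card_inter (Finset.Ico (σ i) (σ i + k)) (D.image σ)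
    rwa [Nat.card_Ico, Nat.add_sub_cancel_left, Finset.inter_comm,
      ← Finset.filter_mem_eq_inter, Finset.filter_image, Finset.card_image_of_injOn] at this
    exact hσ.injOn.mono (Finset.coe_subset.2 (Finset.filter_subset _ _))
  by_cases hsub : ∀ d ∈ D, d ∈ Finset.Ico i (i + k) → σ d ∈ Finset.Ico (σ i) (σ i + k)
  · have : (D.filter fun d => d ∈ Finset.Ico i (i + k)) ⊆
      D.filter fun d => d ∈ Finset.Ico i (i + k) ∧ σ d ∈ Finset.Ico (σ i) (σ i + k) :=
      fun d hd => by
        have hd := Finset.mem_filter.1 hd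
        exact Finset.mem_filter.2 ⟨hd.1, hd.2, hsub d hd.1 hd.2⟩
    have := Finset.card_le_card this
    omega
  · push Not at hsub
    obtain ⟨d, hd, hdi, hdσ⟩ := hsub
    have : (D.filter fun d => σ d ∈ Finset.Ico (σ i) (σ i + k)) ⊆
      D.filter fun d => d ∈ Finset.Ico i (i + k) ∧ σ d ∈ Finset.Ico (σ i) (σ i + k) :=
      fun e he => by
        have he := Finset.mem_filter.1 he
        refine Finset.mem_filter.2 ⟨he.1, ?_, he.2⟩
        have h3 := (hσ.le_iff_le hi hd).2 (Finset.mem_Ico.1 hdi).1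
        simp only [Finset.mem_Ico] at hdi hdσ he ⊢
        have h4 := (hσ.le_iff_le hi he.1).1 he.2.1
        have h5 := (hσ.lt_iff_lt he.1 hd).1 (by omega)
        omega
    have := Finset.card_le_card this
    omega

/-- Summed over the base points in `D ⊆ [0, n)`, windows of length `k` contain few positions
outside `D`: each such position is counted at most `k` times. -/
theorem sum_card_window_sdiff_le {D : Finset ℕ} (hD : ∀ i ∈ D, i < n) (k : ℕ) :
    ∑ i ∈ D, (Finset.Ico i (i + k) \ D).card + k * D.card ≤ k * (n + k) := by
  have hsub : D ⊆ Finset.range (n + k) := fun i hi => by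
    have := hD i hi
    simp only [Finset.mem_range]
    omega
  have h1 : ∑ i ∈ D, (Finset.Ico i (i + k) \ D).card
      ≤ ∑ m ∈ Finset.range (n + k) \ D, (D.filter fun i => m ∈ Finset.Ico i (i + k)).card := by
    have := Finset.sum_card_bipartiteAbove_eq_sum_card_bipartiteBelow
      (fun i m => m ∈ Finset.Ico i (i + k)) (s := D) (t := Finset.range (n + k) \ D)
    unfold Finset.bipartiteAbove Finset.bipartiteBelow at this
    rw [← this]
    refine Finset.sum_le_sum fun i hi => Finset.card_le_card fun m hm => ?_
    have := hD i hi
    simp only [Finset.mem_sdiff, Finset.mem_Ico, Finset.mem_filter, Finset.mem_range] at hm ⊢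
    exact ⟨⟨by omega, hm.2⟩, hm.1⟩
  have h2 : ∀ m ∈ Finset.range (n + k) \ D,
      (D.filter fun i => m ∈ Finset.Ico i (i + k)).card ≤ k := fun m _ => by
    have : (D.filter fun i => m ∈ Finset.Ico i (i + k)) ⊆ Finset.Ico (m + 1 - k) (m + 1) :=
      fun i hi => by
        simp only [Finset.mem_filter, Finset.mem_Ico] at hi ⊢
        omega
    refine (Finset.card_le_card this).trans ?_
    rw [Nat.card_Ico]
    omega
  have h3 := Finset.sum_le_card_nsmul _ _ _ h2
  rw [Finset.card_sdiff_of_subset hsub, Finset.card_range, smul_eq_mul] at h3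
  have h4 := Finset.card_le_card hsub
  rw [Finset.card_range] at h4
  calc _ ≤ (n + k - D.card) * k + k * D.card := by omega
    _ = (n + k - D.card + D.card) * k := by ring
    _ = k * (n + k) := by rw [Nat.sub_add_cancel h4, mul_comm]

/-- Comparison of two sums of bounded terms through a partial bijection between the index sets. -/
theorem abs_sum_sub_sum_le {S A A' : Finset ℕ} {σ : ℕ → ℕ} {u v : ℕ → ℝ} {B : ℝ}
    (hS : S ⊆ A) (hσ : Set.InjOn σ S) (hS' : ∀ i ∈ S, σ i ∈ A')
    (hu : ∀ i, |u i| ≤ B) (hv : ∀ i, |v i| ≤ B) (hA : A.card = A'.card) :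
    |∑ i ∈ A, u i - ∑ i ∈ A', v i| ≤
      ∑ i ∈ S, |u i - v (σ i)| + 2 * B * (A.card - S.card : ℝ) := by
  have hS'' : S.image σ ⊆ A' := fun j hj => by
    obtain ⟨i, hi, rfl⟩ := Finset.mem_image.1 hj
    exact hS' i hi
  have hc : (S.image σ).card = S.card := Finset.card_image_of_injOn hσ
  rw [← Finset.sum_sdiff hS, ← Finset.sum_sdiff hS'', Finset.sum_image hσ]
  have bd : ∀ (s : Finset ℕ) (g : ℕ → ℝ), (∀ i, |g i| ≤ B) → |∑ i ∈ s, g i| ≤ s.card * B :=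
    fun s g hg => (Finset.abs_sum_le_sum_abs _ _).trans
      ((Finset.sum_le_card_nsmul _ _ B fun i _ => hg i).trans_eq (by simp))
  have h1 := bd (A \ S) u hu
  have h2 := bd (A' \ S.image σ) v hv
  rw [Finset.card_sdiff_of_subset hS, Nat.cast_sub (Finset.card_le_card hS)] at h1
  rw [Finset.card_sdiff_of_subset hS'', Nat.cast_sub (Finset.card_le_card hS''), hc, ← hA] at h2
  have h3 : |∑ i ∈ S, u i - ∑ i ∈ S, v (σ i)| ≤ ∑ i ∈ S, |u i - v (σ i)| := by
    rw [← Finset.sum_sub_distrib]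
    exact Finset.abs_sum_le_sum_abs _ _
  rw [abs_le] at *
  constructor <;> linarith [h1.1, h1.2, h2.1, h2.2, h3.1, h3.2]

/-- The average of `a` over the window `[i, i + k)`; it is `0` for `k = 0`. -/
noncomputable def windowAvg (k : ℕ) (a : ℕ → ℝ) (i : ℕ) : ℝ :=
  (∑ j ∈ Finset.range k, a (i + j)) / k

theorem abs_windowAvg_le {k : ℕ} {a : ℕ → ℝ} {B : ℝ} (hB : 0 ≤ B) (ha : ∀ i, |a i| ≤ B)
    (i : ℕ) : |windowAvg k a i| ≤ B := by
  unfold windowAvg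
  rw [abs_div, Nat.abs_cast]
  refine div_le_of_le_mul₀ (by positivity) hB ((Finset.abs_sum_le_sum_abs _ _).trans
    ((Finset.sum_le_card_nsmul _ _ B fun i _ => ha _).trans_eq (by simp [mul_comm])))

theorem abs_windowAvg_sub_le {D : Finset ℕ} {σ : ℕ → ℕ} (hσ : StrictMonoOn σ D)
    {a b : ℕ → ℝ} {B ω : ℝ} (hB : 0 ≤ B) (hω : 0 ≤ ω) (ha : ∀ i, |a i| ≤ B) (hb : ∀ i, |b i| ≤ B)
    (hab : ∀ i ∈ D, |a i - b (σ i)| ≤ ω) {k : ℕ} (hk : 0 < k) {i : ℕ} (hi : i ∈ D) :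
    k * |windowAvg k a i - windowAvg k b (σ i)| ≤ k * ω + 2 * B *
      ((Finset.Ico i (i + k) \ D).card + (Finset.Ico (σ i) (σ i + k) \ D.image σ).card) := by
  set S := D.filter fun d => d ∈ Finset.Ico i (i + k) ∧ σ d ∈ Finset.Ico (σ i) (σ i + k)
  have hSm : ∀ d ∈ S, d ∈ D ∧ d ∈ Finset.Ico i (i + k) ∧ σ d ∈ Finset.Ico (σ i) (σ i + k) :=
    fun d hd => Finset.mem_filter.1 hd
  have hSI : S ⊆ Finset.Ico i (i + k) := fun d hd => (hSm d hd).2.1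
  have h := abs_sum_sub_sum_le (S := S) (A := Finset.Ico i (i + k))
    (A' := Finset.Ico (σ i) (σ i + k)) (σ := σ) hSI
    (hσ.injOn.mono fun d hd => (hSm d hd).1) (fun d hd => (hSm d hd).2.2) ha hb (by simp)
  have e : ∀ (g : ℕ → ℝ) (l : ℕ), ∑ j ∈ Finset.Ico l (l + k), g j = k * windowAvg k g l := by
    intro g l
    unfold windowAvg
    rw [Finset.sum_Ico_eq_sum_range, Nat.add_sub_cancel_left,
      mul_div_cancel₀ _ (by positivity)]
  rw [e, e, ← mul_sub, abs_mul, Nat.abs_cast] at h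
  refine h.trans ?_
  have h1 : ∑ d ∈ S, |a d - b (σ d)| ≤ S.card * ω :=
    (Finset.sum_le_card_nsmul _ _ ω fun d hd => hab d (hSm d hd).1).trans_eq (by simp)
  have h2 : S.card ≤ k := by simpa using Finset.card_le_card hSI
  have h3 : (k : ℝ) ≤ S.card + (Finset.Ico i (i + k) \ D).card
      + (Finset.Ico (σ i) (σ i + k) \ D.image σ).card := by exact_mod_cast le_card_window hσ hi k
  have h4 : (S.card : ℝ) * ω ≤ k * ω := by gcongr
  rw [Nat.card_Ico, Nat.add_sub_cancel_left]
  have h5 : 2 * B * ((k : ℝ) - S.card) ≤ 2 * B * ((Finset.Ico i (i + k) \ D).card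
      + (Finset.Ico (σ i) (σ i + k) \ D.image σ).card) := by
    gcongr
    linarith
  linarith

/-- A match of fit close to `n` makes the averages over `[0, n)` of `|A_k - c|` close to each
other, where `A_k` denotes the average over a window of length `k`. Apart from the term `k / n`,
the bound does not depend on `k`. -/
theorem abs_avg_abs_windowAvg_sub_le {D : Finset ℕ} {σ : ℕ → ℕ} (hσ : StrictMonoOn σ D)
    (hD : ∀ i ∈ D, i < n) (hD' : ∀ i ∈ D, σ i < n) (hn : 0 < n)
    {a b : ℕ → ℝ} {B c ω : ℝ} (hB : 0 ≤ B) (hω : 0 ≤ ω) (hc : |c| ≤ B)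
    (ha : ∀ i, |a i| ≤ B) (hb : ∀ i, |b i| ≤ B)
    (hab : ∀ i ∈ D, |a i - b (σ i)| ≤ ω) {k : ℕ} (hk : 0 < k) :
    |(∑ i ∈ Finset.range n, |windowAvg k a i - c|) / n
      - (∑ i ∈ Finset.range n, |windowAvg k b i - c|) / n|
      ≤ ω + 8 * B * (1 - D.card / n) + 4 * B * (k / n) := by
  have hcard : D.card ≤ n := by
    simpa using Finset.card_le_card
      (fun i hi => Finset.mem_range.2 (hD i hi) : D ⊆ Finset.range n)
  have hbd : ∀ (g : ℕ → ℝ), (∀ i, |g i| ≤ B) → ∀ i, |(|windowAvg k g i - c|)| ≤ 2 * B :=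
    fun g hg i => by
      rw [abs_abs]
      have : |windowAvg k g i - c| ≤ |windowAvg k g i| + |c| :=
        norm_sub_le (windowAvg k g i) c
      linarith [abs_windowAvg_le (k := k) hB hg i]
  have h1 := abs_sum_sub_sum_le (S := D) (A := Finset.range n) (A' := Finset.range n) (σ := σ)
    (fun i hi => Finset.mem_range.2 (hD i hi)) hσ.injOn (fun i hi => Finset.mem_range.2 (hD' i hi))
    (hbd a ha) (hbd b hb) rfl
  have h2 : ∀ i ∈ D, k * |(|windowAvg k a i - c| - |windowAvg k b (σ i) - c|)| ≤ k * ω + 2 * B *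
      ((Finset.Ico i (i + k) \ D).card + (Finset.Ico (σ i) (σ i + k) \ D.image σ).card) := by
    intro i hi
    refine le_trans (mul_le_mul_of_nonneg_left ?_ (Nat.cast_nonneg k))
      (abs_windowAvg_sub_le hσ hB hω ha hb hab hk hi)
    refine (abs_abs_sub_abs_le_abs_sub _ _).trans_eq ?_
    congr 1
    ring
  have h3 := Finset.sum_le_sum h2
  have hw1 : ∑ i ∈ D, ((Finset.Ico i (i + k) \ D).card : ℝ) ≤ k * (n + k) - k * D.card := by
    have := sum_card_window_sdiff_le hD k
    rw [le_sub_iff_add_le]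
    exact_mod_cast this
  have hw2 : ∑ i ∈ D, ((Finset.Ico (σ i) (σ i + k) \ D.image σ).card : ℝ)
      ≤ k * (n + k) - k * D.card := by
    have := sum_card_window_sdiff_le (n := n) (D := D.image σ) (fun j hj => by
      obtain ⟨i, hi, rfl⟩ := Finset.mem_image.1 hj
      exact hD' i hi) k
    rw [Finset.sum_image hσ.injOn, Finset.card_image_of_injOn hσ.injOn] at this
    rw [le_sub_iff_add_le]
    exact_mod_cast this
  rw [← Finset.mul_sum, Finset.sum_add_distrib, Finset.sum_const, nsmul_eq_mul,
    ← Finset.mul_sum, Finset.sum_add_distrib] at h3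
  have h4 : ∑ i ∈ D, |(|windowAvg k a i - c| - |windowAvg k b (σ i) - c|)|
      ≤ n * ω + 4 * B * (n - D.card) + 4 * B * k := by
    have hk' : (0 : ℝ) < k := by exact_mod_cast hk
    refine le_of_mul_le_mul_left (h3.trans ?_) hk'
    have : (D.card : ℝ) * (k * ω) ≤ n * (k * ω) := by gcongr
    nlinarith [mul_le_mul_of_nonneg_left (add_le_add hw1 hw2) (by positivity : 0 ≤ 2 * B)]
  have hn' : (0 : ℝ) < n := by exact_mod_cast hn
  rw [← sub_div, abs_div, Nat.abs_cast, div_le_iff₀ hn']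
  have h5 : (ω + 8 * B * (1 - D.card / n) + 4 * B * (k / n)) * n
      = n * ω + 8 * B * (n - D.card) + 4 * B * k := by
    field_simp
  rw [h5]
  rw [Finset.card_range] at h1
  linarith

end Combinatorics

/-! ### Mean convergence of Birkhoff averages and ergodicity -/

section Ergodic

variable {Y : Type*} [MeasurableSpace Y] {T : Y → Y}

theorem integrable_comp_iterate {μ : Measure Y} (hT : MeasurePreserving T μ μ) {f : Y → ℝ}
    (hf : Integrable f μ) (j : ℕ) : Integrable (fun y => f (T^[j] y)) μ :=
  (hT.iterate j).integrable_comp_of_integrable hf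

theorem integral_birkhoffAverage {μ : Measure Y} (hT : MeasurePreserving T μ μ) {f : Y → ℝ}
    (hf : Integrable f μ) {k : ℕ} (hk : 0 < k) :
    ∫ y, birkhoffAverage ℝ T f k y ∂μ = ∫ y, f y ∂μ := by
  have hi : ∀ j, ∫ y, f (T^[j] y) ∂μ = ∫ y, f y ∂μ := fun j => by
    have h := (hT.iterate j).map_eq
    conv_rhs => rw [← h]
    rw [integral_map (hT.iterate j).measurable.aemeasurable (by rw [h]; exact hf.1)]
  simp only [birkhoffAverage, birkhoffSum, smul_eq_mul]
  rw [integral_const_mul,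
    integral_finsetSum _ fun j _ => integrable_comp_iterate hT hf j]
  simp only [hi, Finset.sum_const, Finset.card_range, nsmul_eq_mul]
  field_simp

theorem integrable_birkhoffAverage {μ : Measure Y} (hT : MeasurePreserving T μ μ) {f : Y → ℝ}
    (hf : Integrable f μ) (k : ℕ) : Integrable (birkhoffAverage ℝ T f k) μ := by
  unfold birkhoffAverage birkhoffSum
  exact (integrable_finsetSum _ fun j _ => integrable_comp_iterate hT hf j).const_mul _

/-- The mean ergodic theorem for an ergodic map, with convergence in `L¹`. -/
theorem tendsto_integral_abs_birkhoffAverage_sub {μ : Measure Y} [IsProbabilityMeasure μ]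
    (hT : Ergodic T μ) {f : Y → ℝ} (hf : MemLp f 2 μ) :
    Tendsto (fun k : ℕ => ∫ y, |birkhoffAverage ℝ T f k y - ∫ y', f y' ∂μ| ∂μ) atTop (𝓝 0) := by
  have hmp := hT.toMeasurePreserving
  have hfi : Integrable f μ := hf.integrable one_le_two
  set U : Lp ℝ 2 μ →L[ℝ] Lp ℝ 2 μ :=
    (Lp.compMeasurePreservingₗᵢ ℝ T hmp).toContinuousLinearMap
  have hUapp : ⇑U = Lp.compMeasurePreserving T hmp := rfl
  set F : Lp ℝ 2 μ := hf.toLp f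
  set P := (U.eqLocus (1 : Lp ℝ 2 μ →L[ℝ] Lp ℝ 2 μ)).orthogonalProjectionOnto F
  have hlim := U.tendsto_birkhoffAverage_orthogonalProjection
    (LinearIsometry.norm_toContinuousLinearMap_le _) F
  -- the projection of `f` onto the invariant functions is constant, as `T` is ergodic
  obtain ⟨c, hc⟩ : ∃ c, (P : Lp ℝ 2 μ) =ᵐ[μ] Function.const Y c := by
    refine hT.ae_eq_const_of_ae_eq_comp_ae (Lp.aestronglyMeasurable _) ?_
    have h1 : U (P : Lp ℝ 2 μ) = P := P.2
    have h2 := Lp.coeFn_compMeasurePreserving (P : Lp ℝ 2 μ) hmp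
    rw [← hUapp, h1] at h2
    exact h2.symm
  have hiter : ∀ j, (U^[j] F : Lp ℝ 2 μ) =ᵐ[μ] fun y => f (T^[j] y) := fun j => by
    rw [hUapp, Lp.compMeasurePreserving_iterate, Lp.toLp_compMeasurePreserving]
    exact MemLp.coeFn_toLp _
  have hsum : ∀ k, (birkhoffSum U id k F : Lp ℝ 2 μ) =ᵐ[μ] birkhoffSum T f k := fun k => by
    induction k with
    | zero => simpa using Lp.coeFn_zero ℝ 2 μ
    | succ k ih =>
      rw [birkhoffSum_succ]
      filter_upwards [Lp.coeFn_add (birkhoffSum U id k F) (id (U^[k] F)), ih, hiter k]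
        with y h1 h2 h3
      rw [h1, Pi.add_apply, h2, birkhoffSum_succ, id, h3]
  have havg : ∀ k, (birkhoffAverage ℝ U id k F - P : Lp ℝ 2 μ) =ᵐ[μ]
      fun y => birkhoffAverage ℝ T f k y - c := fun k => by
    filter_upwards [Lp.coeFn_sub (birkhoffAverage ℝ U id k F) (P : Lp ℝ 2 μ), hc, hsum k,
      Lp.coeFn_smul (k : ℝ)⁻¹ (birkhoffSum U id k F)] with y h1 h2 h3 h4
    rw [h1, Pi.sub_apply, h2]
    simp only [birkhoffAverage]
    rw [h4, Pi.smul_apply, h3]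
    rfl
  have hle : ∀ k, ∫ y, |birkhoffAverage ℝ T f k y - c| ∂μ
      ≤ ‖(birkhoffAverage ℝ U id k F - P : Lp ℝ 2 μ)‖ := fun k => by
    have h1 : ∫ y, |birkhoffAverage ℝ T f k y - c| ∂μ
        = ∫ y, ‖(birkhoffAverage ℝ U id k F - P : Lp ℝ 2 μ) y‖ ∂μ :=
      integral_congr_ae ((havg k).mono fun y hy => by simp only [hy, Real.norm_eq_abs])
    rw [h1, integral_norm_eq_lintegral_enorm (Lp.aestronglyMeasurable _), Lp.norm_def,
      ← eLpNorm_one_eq_lintegral_enorm]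
    exact ENNReal.toReal_mono (Lp.eLpNorm_ne_top _)
      (eLpNorm_le_eLpNorm_of_exponent_le one_le_two (Lp.aestronglyMeasurable _))
  have hlim0 : Tendsto (fun k => ∫ y, |birkhoffAverage ℝ T f k y - c| ∂μ) atTop (𝓝 0) :=
    squeeze_zero (fun k => integral_nonneg fun y => abs_nonneg _) hle
      (tendsto_iff_norm_sub_tendsto_zero.1 hlim)
  -- the constant is the integral of `f`, because Birkhoff averages have the same integral as `f`
  have hceq : ∫ y, f y ∂μ = c := by
    refine eq_of_abs_sub_nonpos (ge_of_tendsto hlim0 (eventually_gt_atTop 0 |>.mono fun k hk => ?_))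
    have : ∫ y, f y ∂μ - c = ∫ y, (birkhoffAverage ℝ T f k y - c) ∂μ := by
      rw [integral_sub (integrable_birkhoffAverage hmp hfi k) (integrable_const c),
        integral_birkhoffAverage hmp hfi hk]
      simp
    rw [this]
    exact abs_integral_le_integral_abs
  rw [hceq]
  exact hlim0

/-- An invariant measure is ergodic if Birkhoff averages of continuous functions come arbitrarily
close to constants in `L¹`. Indeed `f` and its Birkhoff averages have the same integral over every
invariant set `s`, so that `∫ f` over `s` equals `μ s * ∫ f`; hence `μ` restricted to `s` is
`μ s • μ`, and `μ s` is idempotent. -/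
theorem ergodic_of_forall_exists_integral_abs_le [TopologicalSpace Y] [HasOuterApproxClosed Y]
    [BorelSpace Y] {μ : Measure Y} [IsProbabilityMeasure μ] (hT : MeasurePreserving T μ μ)
    (h : ∀ f : BoundedContinuousFunction Y ℝ, ∀ ε : ℝ, 0 < ε → ∃ k : ℕ, 0 < k ∧ ∃ c : ℝ,
      ∫ y, |birkhoffAverage ℝ T f k y - c| ∂μ ≤ ε) : Ergodic T μ := by
  refine ⟨hT, ⟨fun s hs hTs => ?_⟩⟩
  have hTr : MeasurePreserving T (μ.restrict s) (μ.restrict s) := by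
    simpa [hTs] using hT.restrict_preimage hs
  have hres : μ.restrict s = μ s • μ := by
    have : IsFiniteMeasure (μ s • μ) := μ.smul_finite (measure_ne_top μ s)
    refine ext_of_forall_integral_eq_of_IsFiniteMeasure fun f => ?_
    rw [integral_smul_measure, smul_eq_mul]
    refine eq_of_abs_sub_nonpos (le_of_forall_pos_le_add fun ε hε => ?_)
    obtain ⟨k, hk, c, hc⟩ := h f (ε / 2) (half_pos hε)
    have hf : Integrable f μ := f.integrable μ
    have hA := integrable_birkhoffAverage hT hf k
    have h1 : |∫ y in s, f y ∂μ - (μ s).toReal * c| ≤ ε / 2 := by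
      have : ∫ y in s, f y ∂μ - (μ s).toReal * c
          = ∫ y in s, (birkhoffAverage ℝ T f k y - c) ∂μ := by
        rw [integral_sub hA.integrableOn (integrable_const c),
          integral_birkhoffAverage hTr hf.integrableOn hk]
        simp [Measure.real]
      rw [this]
      refine abs_integral_le_integral_abs.trans (le_trans ?_ hc)
      exact setIntegral_le_integral (hA.sub (integrable_const c)).abs
        (Eventually.of_forall fun y => abs_nonneg _)
    have h2 : |∫ y, f y ∂μ - c| ≤ ε / 2 := by
      have : ∫ y, f y ∂μ - c = ∫ y, (birkhoffAverage ℝ T f k y - c) ∂μ := by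
        rw [integral_sub hA (integrable_const c), integral_birkhoffAverage hT hf hk]
        simp
      rw [this]
      exact abs_integral_le_integral_abs.trans hc
    have h3 : (μ s).toReal ≤ 1 := ENNReal.toReal_le_of_le_ofReal zero_le_one (by simp [prob_le_one])
    have h4 : |(μ s).toReal * (∫ y, f y ∂μ - c)| ≤ ε / 2 := by
      rw [abs_mul, abs_of_nonneg ENNReal.toReal_nonneg]
      exact (mul_le_of_le_one_left (abs_nonneg _) h3).trans h2
    rw [abs_le] at *
    constructor <;> linarith [h1.1, h1.2, h4.1, h4.2]
  have hidem : μ s = μ s * μ s := by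
    have := congrArg (fun ν : Measure Y => ν s) hres
    simpa using this
  have h01 : μ s = 0 ∨ μ s = 1 := by
    by_cases h0 : μ s = 0
    · exact Or.inl h0
    · refine Or.inr (((ENNReal.mul_right_inj h0 (measure_ne_top μ s)).1 ?_).symm)
      rw [mul_one, ← hidem]
  rw [eventuallyConst_set]
  rcases h01 with h0 | h1
  · exact Or.inr (measure_eq_zero_iff_ae_notMem.1 h0)
  · exact Or.inl ((prob_compl_eq_zero_iff hs).2 h1)

end Ergodic

/-! ### Generic sequences and averages of continuous functions -/

section Generic

theorem IsGeneric.unique {X : Type*} [MetricSpace X] [MeasurableSpace X] [BorelSpace X]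
    {x : ℕ → X} {μ ν : ProbabilityMeasure X} (h : IsGeneric x μ) (h' : IsGeneric x ν) : μ = ν :=
  Set.singleton_injective (h.symm.trans h')

variable {X : Type*} [MetricSpace X] [CompactSpace X] [MeasurableSpace X] [BorelSpace X]

theorem integrable_of_continuous {f : X → ℝ} (hf : Continuous f) (μ : Measure X)
    [IsFiniteMeasure μ] : Integrable f μ :=
  (BoundedContinuousFunction.mkOfCompact ⟨f, hf⟩).integrable μ

theorem tendsto_iff_forall_continuous {ι : Type*} {l : Filter ι} {ν : ι → ProbabilityMeasure X}
    {μ : ProbabilityMeasure X} :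
    Tendsto ν l (𝓝 μ) ↔ ∀ f : X → ℝ, Continuous f →
      Tendsto (fun i => ∫ y, f y ∂(ν i : Measure X)) l (𝓝 (∫ y, f y ∂(μ : Measure X))) := by
  rw [ProbabilityMeasure.tendsto_iff_forall_integral_tendsto]
  exact ⟨fun h f hf => h (BoundedContinuousFunction.mkOfCompact ⟨f, hf⟩),
    fun h f => h f f.continuous⟩

theorem integral_empirical {f : X → ℝ} (hf : Continuous f) (x : ℕ → X) (n : ℕ+) :
    ∫ y, f y ∂(empirical x n : Measure X) = (∑ j ∈ Finset.range n, f (x j)) / (n : ℕ) := by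
  change ∫ y, f y ∂(((n : ℕ) : ENNReal)⁻¹ • ∑ j ∈ Finset.range n, Measure.dirac (x j)) = _
  rw [integral_smul_measure, integral_finsetSum_measure fun j _ => integrable_of_continuous hf _]
  simp only [integral_dirac, smul_eq_mul, ENNReal.toReal_inv, ENNReal.toReal_natCast]
  rw [div_eq_inv_mul]

/-- By compactness of the space of probability measures, the empirical measures of a generic
sequence converge, and not only those of their subsequences that do converge at all. -/
theorem IsGeneric.tendsto_avg {x : ℕ → X} {μ : ProbabilityMeasure X} (h : IsGeneric x μ)
    {f : X → ℝ} (hf : Continuous f) :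
    Tendsto (fun n : ℕ => (∑ j ∈ Finset.range n, f (x j)) / n) atTop
      (𝓝 (∫ y, f y ∂(μ : Measure X))) := by
  have hemp : Tendsto (fun n : ℕ => empirical x n.succPNat) atTop (𝓝 μ) := by
    refine tendsto_of_subseq_tendsto fun ns hns => ?_
    obtain ⟨φ, -, hφ⟩ := strictMono_subseq_of_tendsto_atTop hns
    obtain ⟨ν, ψ, hψ, hν⟩ :=
      CompactSpace.tendsto_subseq fun i => empirical x ((ns ∘ φ) i).succPNat
    have hmem : ν ∈ generated x := ⟨fun i => ((ns ∘ φ) (ψ i)).succPNat, fun i j hij =>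
      Nat.succPNat_lt_succPNat.2 (hφ (hψ hij)), hν⟩
    rw [h, Set.mem_singleton_iff] at hmem
    exact ⟨φ ∘ ψ, hmem ▸ hν⟩
  rw [← tendsto_add_atTop_iff_nat 1]
  refine (tendsto_iff_forall_continuous.1 hemp f hf).congr fun n => ?_
  rw [integral_empirical hf]
  rfl

theorem isGeneric_of_tendsto_avg {x : ℕ → X} {μ : ProbabilityMeasure X}
    (h : ∀ f : X → ℝ, Continuous f →
      Tendsto (fun n : ℕ => (∑ j ∈ Finset.range n, f (x j)) / n) atTop
        (𝓝 (∫ y, f y ∂(μ : Measure X)))) : IsGeneric x μ := by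
  have key : ∀ φ : ℕ → ℕ+, StrictMono φ →
      Tendsto (fun i => empirical x (φ i)) atTop (𝓝 μ) := fun φ hφ => by
    refine tendsto_iff_forall_continuous.2 fun f hf => ?_
    have hφ' : StrictMono fun i => (φ i : ℕ) := fun i j hij => hφ hij
    exact ((h f hf).comp hφ'.tendsto_atTop).congr fun i => (integral_empirical hf x (φ i)).symm
  refine Set.eq_singleton_iff_unique_mem.2
    ⟨⟨Nat.succPNat, fun i j hij => Nat.succPNat_lt_succPNat.2 hij, key _ fun i j hij =>
      Nat.succPNat_lt_succPNat.2 hij⟩, ?_⟩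
  rintro ν ⟨φ, hφ, hν⟩
  exact tendsto_nhds_unique hν (key φ hφ)

end Generic

/-! ### Averages of sequences that are close for the Feldman-Katok pseudometric -/

section Transfer

theorem continuous_birkhoffAverage {X : Type*} [TopologicalSpace X] {T : X → X}
    (hT : Continuous T) {f : X → ℝ} (hf : Continuous f) (k : ℕ) :
    Continuous (birkhoffAverage ℝ T f k) := by
  unfold birkhoffAverage birkhoffSum
  exact continuous_const.mul (continuous_finsetSum _ fun j _ => hf.comp (hT.iterate j))

variable {X : Type*} [MetricSpace X] [CompactSpace X]

theorem exists_forall_abs_le {f : X → ℝ} (hf : Continuous f) : ∃ B, 0 ≤ B ∧ ∀ y, |f y| ≤ B :=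
  let g := BoundedContinuousFunction.mkOfCompact ⟨f, hf⟩
  ⟨‖g‖, norm_nonneg g, g.norm_coe_le_norm⟩

/-- The closeness required for the averages of `|A_k f - c|` to differ by at most `ε` does not
depend on the window length `k`. -/
theorem exists_forall_FK_lt_windowAvg {f : X → ℝ} (hf : Continuous f) {B : ℝ} (hB : 0 ≤ B)
    (hfB : ∀ y, |f y| ≤ B) {ε : ℝ} (hε : 0 < ε) :
    ∃ δ > 0, ∀ x z : ℕ → X, FK x z < δ → ∀ k : ℕ, 0 < k → ∀ c : ℝ, |c| ≤ B →
      ∀ᶠ n : ℕ in atTop,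
        |(∑ i ∈ Finset.range n, |windowAvg k (fun j => f (x j)) i - c|) / n
          - (∑ i ∈ Finset.range n, |windowAvg k (fun j => f (z j)) i - c|) / n| ≤ ε := by
  obtain ⟨δ₀, hδ₀, hfδ⟩ :=
    Metric.uniformContinuous_iff.1 (CompactSpace.uniformContinuous_of_continuous hf) (ε / 3)
      (by positivity)
  -- `8 * B * δ ≤ ε / 3`, where `+ 1` covers the case `B = 0`
  refine ⟨min δ₀ (ε / (24 * B + 1)), by positivity, fun x z hxz k hk c hc => ?_⟩
  have hlim : Tendsto (fun n : ℕ => 4 * B * ((k : ℝ) / n)) atTop (𝓝 0) := by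
    simpa using (tendsto_const_div_atTop_nhds_zero_nat (k : ℝ)).const_mul (4 * B)
  filter_upwards [eventually_gap_lt hxz, hlim.eventually_le_const (by positivity : 0 < ε / 3),
    eventually_gt_atTop 0] with n hgap hkn hn
  obtain ⟨D, σ, h, hD⟩ := exists_isMatchOn x z n (min δ₀ (ε / (24 * B + 1)))
  have hgap' : 1 - (D.card : ℝ) / n ≤ ε / (24 * B + 1) := by
    rw [hD]
    exact (hgap.trans_le (min_le_right _ _)).le
  have hB' : 8 * B * (1 - (D.card : ℝ) / n) ≤ ε / 3 := by
    refine (mul_le_mul_of_nonneg_left hgap' (by positivity)).trans ?_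
    rw [← mul_div_assoc, div_le_iff₀ (by positivity)]
    nlinarith
  have := abs_avg_abs_windowAvg_sub_le (k := k) (c := c) (a := fun j => f (x j))
    (b := fun j => f (z j)) h.mono h.lt_dom h.lt_ran hn hB (by positivity : 0 ≤ ε / 3) hc
    (fun j => hfB _) (fun j => hfB _)
    (fun i hi => (hfδ ((h.close i hi).trans_le (min_le_left _ _))).le) hk
  linarith

theorem exists_forall_FK_lt_avg {f : X → ℝ} (hf : Continuous f) {ε : ℝ} (hε : 0 < ε) :
    ∃ δ > 0, ∀ x z : ℕ → X, FK x z < δ → ∀ᶠ n : ℕ in atTop,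
        |(∑ i ∈ Finset.range n, f (x i)) / n - (∑ i ∈ Finset.range n, f (z i)) / n| ≤ ε := by
  obtain ⟨B, hB, hfB⟩ := exists_forall_abs_le hf
  obtain ⟨δ, hδ, h⟩ := exists_forall_FK_lt_windowAvg hf hB hfB hε
  refine ⟨δ, hδ, fun x z hxz => ?_⟩
  -- windows of length one and `c = -B`, for which `|f - c| = f + B`
  filter_upwards [h x z hxz 1 one_pos (-B) (by rw [abs_neg, abs_of_nonneg hB]),
    eventually_gt_atTop 0] with n hn hn0
  have hw : ∀ (w : ℕ → X) i, |windowAvg 1 (fun j => f (w j)) i - -B| = f (w i) + B :=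
    fun w i => by
      have := (abs_le.1 (hfB (w i))).1
      rw [sub_neg_eq_add, abs_of_nonneg] <;> simp [windowAvg]
      linarith
  have hs : ∀ w : ℕ → X, (∑ i ∈ Finset.range n, |windowAvg 1 (fun j => f (w j)) i - -B|) / n
      = (∑ i ∈ Finset.range n, f (w i)) / n + B := fun w => by
    simp only [hw, Finset.sum_add_distrib, Finset.sum_const, Finset.card_range, nsmul_eq_mul]
    field_simp
  rw [hs, hs] at hn
  simpa using hn

variable [MeasurableSpace X] [BorelSpace X] {T : X → X}

theorem exists_forall_FK_lt_integral (hT : Continuous T) {f : X → ℝ} (hf : Continuous f) {B : ℝ}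
    (hB : 0 ≤ B) (hfB : ∀ y, |f y| ≤ B) {ε : ℝ} (hε : 0 < ε) :
    ∃ δ > 0, ∀ (x y : X) (μ ν : ProbabilityMeasure X), IsGeneric (trajectory T x) μ →
      IsGeneric (trajectory T y) ν → FK (trajectory T x) (trajectory T y) < δ →
      ∀ k : ℕ, 0 < k → ∀ c : ℝ, |c| ≤ B →
        |∫ u, |birkhoffAverage ℝ T f k u - c| ∂(μ : Measure X)
          - ∫ u, |birkhoffAverage ℝ T f k u - c| ∂(ν : Measure X)| ≤ ε := by
  obtain ⟨δ, hδ, h⟩ := exists_forall_FK_lt_windowAvg hf hB hfB hε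
  refine ⟨δ, hδ, fun x y μ ν hμ hν hxy k hk c hc => ?_⟩
  have hcont : Continuous fun u => |birkhoffAverage ℝ T f k u - c| :=
    ((continuous_birkhoffAverage hT hf k).sub continuous_const).abs
  have hw : ∀ (w : X) i, windowAvg k (fun j => f (trajectory T w j)) i
      = birkhoffAverage ℝ T f k (trajectory T w i) := fun w i => by
    unfold windowAvg birkhoffAverage birkhoffSum trajectory
    rw [smul_eq_mul, div_eq_inv_mul]
    congr 1
    refine Finset.sum_congr rfl fun j _ => ?_
    rw [← Function.iterate_add_apply, add_comm]
  have hev := h _ _ hxy k hk c hc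
  simp only [hw] at hev
  exact le_of_tendsto ((hμ.tendsto_avg hcont).sub (hν.tendsto_avg hcont)).abs hev

end Transfer

/-! ### The limit measure -/

section Limit

variable {X : Type*} [MetricSpace X] [CompactSpace X] [MeasurableSpace X] [BorelSpace X]
  {T : X → X}

/-- The measures generated by a Cauchy sequence of generic sequences converge. -/
theorem exists_tendsto_of_isFKCauchy {x : ℕ → ℕ → X} {ν : ℕ → ProbabilityMeasure X}
    (hν : ∀ p, IsGeneric (x p) (ν p)) (hC : IsFKCauchy x) :
    ∃ μ : ProbabilityMeasure X, Tendsto ν atTop (𝓝 μ) := by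
  obtain ⟨μ, φ, hφ, hμ⟩ := CompactSpace.tendsto_subseq ν
  refine ⟨μ, tendsto_iff_forall_continuous.2 fun f hf => ?_⟩
  have hcauchy : CauchySeq fun p => ∫ y, f y ∂(ν p : Measure X) := by
    refine Metric.cauchySeq_iff.2 fun ε hε => ?_
    obtain ⟨δ, hδ, h⟩ := exists_forall_FK_lt_avg hf (half_pos hε)
    obtain ⟨N, hN⟩ := hC δ hδ
    refine ⟨N, fun k hk l hl => lt_of_le_of_lt ?_ (half_lt_self hε)⟩
    exact le_of_tendsto (((hν k).tendsto_avg hf).sub ((hν l).tendsto_avg hf)).abs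
      (h _ _ (hN k l hk hl))
  exact tendsto_nhds_of_cauchySeq_of_subseq hcauchy hφ.tendsto_atTop
    (tendsto_iff_forall_continuous.1 hμ f hf)

/-- A limit of generic sequences is generic for the limit measure. -/
theorem IsFKLimit.isGeneric {x : ℕ → ℕ → X} {z : ℕ → X} (hz : IsFKLimit x z)
    {ν : ℕ → ProbabilityMeasure X} (hν : ∀ p, IsGeneric (x p) (ν p)) {μ : ProbabilityMeasure X}
    (hμ : Tendsto ν atTop (𝓝 μ)) : IsGeneric z μ := by
  refine isGeneric_of_tendsto_avg fun f hf => Metric.tendsto_nhds.2 fun ε hε => ?_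
  obtain ⟨δ, hδ, h⟩ := exists_forall_FK_lt_avg hf (by positivity : 0 < ε / 3)
  obtain ⟨p, hp, hpμ⟩ := ((hz.eventually_lt_const hδ).and (Metric.tendsto_nhds.1
    (tendsto_iff_forall_continuous.1 hμ f hf) (ε / 3) (by positivity))).exists
  filter_upwards [h _ _ hp, Metric.tendsto_nhds.1 ((hν p).tendsto_avg hf) (ε / 3) (by positivity)]
    with n h1 h2
  rw [Real.dist_eq, abs_lt] at *
  rw [abs_le] at h1
  constructor <;> linarith [h1.1, h1.2, h2.1, h2.2, hpμ.1, hpμ.2]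

theorem measurePreserving_of_tendsto (hT : Continuous T) {ν : ℕ → ProbabilityMeasure X}
    (hν : ∀ p, MeasurePreserving T (ν p : Measure X) (ν p)) {μ : ProbabilityMeasure X}
    (hμ : Tendsto ν atTop (𝓝 μ)) : MeasurePreserving T (μ : Measure X) μ := by
  refine ⟨hT.measurable, ?_⟩
  have : IsFiniteMeasure ((μ : Measure X).map T) := Measure.isFiniteMeasure_map _ _
  refine ext_of_forall_integral_eq_of_IsFiniteMeasure fun f => ?_
  rw [integral_map hT.measurable.aemeasurable f.continuous.aestronglyMeasurable]
  refine tendsto_nhds_unique (tendsto_iff_forall_continuous.1 hμ _ (f.continuous.comp hT))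
    ((tendsto_iff_forall_continuous.1 hμ _ f.continuous).congr fun p => ?_)
  conv_lhs => rw [← (hν p).map_eq]
  exact integral_map hT.measurable.aemeasurable f.continuous.aestronglyMeasurable

/-- The limit measure is ergodic: for one large `p` the Birkhoff averages of length `k` are, for
some `k`, close in mean to a constant; this passes to all later indices with the same `k`, and so
to the limit. -/
theorem ergodic_of_isFKCauchy (hT : Continuous T) {x : ℕ → X}
    (hC : IsFKCauchy fun p => trajectory T (x p)) {ν : ℕ → ProbabilityMeasure X}
    (hν : ∀ p, IsGeneric (trajectory T (x p)) (ν p)) (herg : ∀ p, Ergodic T (ν p : Measure X))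
    {μ : ProbabilityMeasure X} (hμ : Tendsto ν atTop (𝓝 μ)) : Ergodic T (μ : Measure X) := by
  refine ergodic_of_forall_exists_integral_abs_le
    (measurePreserving_of_tendsto hT (fun p => (herg p).toMeasurePreserving) hμ) fun f ε hε => ?_
  have hf := f.continuous
  obtain ⟨B, hB, hfB⟩ := exists_forall_abs_le hf
  obtain ⟨δ, hδ, h⟩ := exists_forall_FK_lt_integral hT hf hB hfB (half_pos hε)
  obtain ⟨N, hN⟩ := hC δ hδ
  set c := ∫ y, f y ∂(ν N : Measure X)
  have hc : |c| ≤ B := by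
    have := norm_integral_le_of_norm_le_const (μ := (ν N : Measure X)) (f := f)
      (Eventually.of_forall hfB)
    simpa using this
  obtain ⟨k, hk, hk0⟩ := (((tendsto_integral_abs_birkhoffAverage_sub (herg N)
    (f.memLp_top.mono_exponent le_top)).eventually_le_const (half_pos hε)).and
      (eventually_gt_atTop 0)).exists
  have hcont : Continuous fun u => |birkhoffAverage ℝ T f k u - c| :=
    ((continuous_birkhoffAverage hT hf k).sub continuous_const).abs
  refine ⟨k, hk0, c, le_of_tendsto (tendsto_iff_forall_continuous.1 hμ _ hcont)
    ((eventually_ge_atTop N).mono fun q hq => ?_)⟩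
  have := (abs_le.1 (h (x N) (x q) _ _ (hν N) (hν q) (hN N q le_rfl hq) k hk0 c hc)).1
  linarith

end Limit

/-! ### A limit sequence made of blocks -/

section Construction

/-- A sequence made of blocks of trajectories is a quasi-orbit if there are at most `√n` blocks
below `n`. -/
theorem isQuasiOrbit_blocks {X : Type*} {T : X → X} {x : ℕ → X} {b : ℕ → ℕ} (hb : Monotone b)
    (hbn : ∀ n, b n ^ 2 ≤ n) : IsQuasiOrbit T fun i => trajectory T (x (b i)) i := by
  set A := {n : ℕ | trajectory T (x (b (n + 1))) (n + 1) ≠ T (trajectory T (x (b n)) n)}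
  have hA : ∀ i ∈ A, b i < b (i + 1) := fun i hi => by
    refine lt_of_le_of_ne (hb (Nat.le_succ i)) fun h => hi ?_
    rw [← h]
    exact Function.iterate_succ_apply' T i _
  have hcard : ∀ n, (A ∩ Set.Iio n).ncard ≤ b n := fun n => by
    have hmono : StrictMonoOn b A := fun i hi j _ hij => (hA i hi).trans_le (hb hij)
    have := Set.ncard_le_ncard_of_injOn (s := A ∩ Set.Iio n) (t := Set.Iio (b n)) b
      (fun i hi => (hA i hi.1).trans_le (hb hi.2))
      (hmono.injOn.mono Set.inter_subset_left) (Set.finite_Iio _)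
    simpa [← Finset.coe_Iio, Set.ncard_coe_finset] using this
  have hle : ∀ n : ℕ, ((A ∩ Set.Iio n).ncard : ℝ) / n ≤ (Real.sqrt n)⁻¹ := fun n => by
    have h1 : ((A ∩ Set.Iio n).ncard : ℝ) ≤ Real.sqrt n := by
      refine (Nat.cast_le.2 (hcard n)).trans (Real.le_sqrt_of_sq_le ?_)
      exact_mod_cast hbn n
    rw [← Real.sqrt_div_self]
    gcongr
  exact (squeeze_zero (fun n => by positivity) hle (tendsto_inv_atTop_zero.comp
    (Real.tendsto_sqrt_atTop.comp tendsto_natCast_atTop_atTop))).limsup_eq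

variable {X : Type*} [MetricSpace X]

/-- Block boundaries that grow fast and exceed prescribed thresholds. -/
theorem exists_fast_growing (M : ℕ → ℕ → ℕ) : ∃ s : ℕ → ℕ, s 0 = 0 ∧ StrictMono s ∧
    (∀ j, j ^ 2 ≤ s j) ∧ (∀ j, (j + 1) * s j ≤ s (j + 1)) ∧ ∀ j p, p ≤ j → 0 < j → M p j ≤ s j := by
  set s : ℕ → ℕ := fun j => Nat.rec 0 (fun i a =>
    (i + 1) * a + a + (i + 1) ^ 2 + ∑ p ∈ Finset.range (i + 2), M p (i + 1)) j
  have hs : ∀ j, s (j + 1) =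
    (j + 1) * s j + s j + (j + 1) ^ 2 + ∑ p ∈ Finset.range (j + 2), M p (j + 1) := fun j => rfl
  refine ⟨s, rfl, strictMono_nat_of_lt_succ fun j => ?_, fun j => ?_, fun j => ?_,
    fun j p hp hj => ?_⟩
  · have : 0 < (j + 1) ^ 2 := by positivity
    rw [hs]
    omega
  · cases j with
    | zero => simp
    | succ j =>
      rw [hs]
      omega
  · rw [hs]
    omega
  · obtain ⟨i, rfl⟩ := Nat.exists_eq_succ_of_ne_zero hj.ne'
    have := Finset.single_le_sum (f := fun p => M p (i + 1)) (fun _ _ => Nat.zero_le _)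
      (Finset.mem_range.2 (by omega : p < i + 2))
    rw [Nat.succ_eq_add_one, hs]
    omega

theorem exists_block_index {s : ℕ → ℕ} (h0 : s 0 = 0) (hs : StrictMono s) :
    ∃ b : ℕ → ℕ, ∀ i, s (b i) ≤ i ∧ i < s (b i + 1) := by
  refine ⟨fun i => Nat.findGreatest (fun j => s j ≤ i) i, fun i => ⟨?_, ?_⟩⟩
  · exact Nat.findGreatest_spec (P := fun j => s j ≤ i) (Nat.zero_le i) (by simp [h0])
  · by_contra! h
    have := Nat.le_findGreatest (P := fun j => s j ≤ i) (hs.le_apply.trans h) h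
    omega

/-- The gap of the concatenated sequence below `n` is controlled by the gap on the current block,
the gap on the previous block, and the length of everything before that. -/
theorem gap_le_of_blocks {x z w w' : ℕ → X} {l m n : ℕ} {δ η : ℝ} (hlm : l ≤ m) (hmn : m ≤ n)
    (hn : 0 < n) (hz : ∀ i, m ≤ i → i < n → z i = w i) (hz' : ∀ i, l ≤ i → i < m → z i = w' i)
    (hw : gap n δ x w ≤ η) (hw' : gap m δ x w' ≤ η) (hη : 0 ≤ η) :
    gap n δ x z ≤ 2 * η + l / n := by
  have h1 : (maxFit x z m δ : ℝ) + maxFit x w n δ ≤ maxFit x z n δ + m := by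
    exact_mod_cast maxFit_add_le hmn hz
  have h2 : (maxFit x z l δ : ℝ) + maxFit x w' m δ ≤ maxFit x z m δ + l := by
    exact_mod_cast maxFit_add_le hlm hz'
  have key : ∀ (u : ℕ → X) (k : ℕ), gap k δ x u ≤ η → (k : ℝ) - maxFit x u k δ ≤ η * k := by
    intro u k hk
    rcases Nat.eq_zero_or_pos k with rfl | hk0
    · simp
    · have hk0' : (0 : ℝ) < k := by exact_mod_cast hk0
      have : (1 - (maxFit x u k δ : ℝ) / k) * k ≤ η * k :=
        mul_le_mul_of_nonneg_right hk hk0'.le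
      rwa [sub_mul, one_mul, div_mul_cancel₀ _ hk0'.ne'] at this
  have h3 := key w n hw
  have h4 := key w' m hw'
  have h5 : η * m ≤ η * n := by gcongr
  have h6 : (0 : ℝ) ≤ maxFit x z l δ := by positivity
  have hn' : (0 : ℝ) < n := by exact_mod_cast hn
  refine le_of_mul_le_mul_right ?_ hn'
  unfold gap
  have h7 : (1 - (maxFit x z n δ : ℝ) / n) * n = n - maxFit x z n δ := by field_simp
  have h8 : (2 * η + (l : ℝ) / n) * n = 2 * (η * n) + l := by field_simp
  rw [h7, h8]
  linarith

/-- A Cauchy sequence `x` has a limit that coincides with `x j` on the `j`-th of a sequence of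
fast growing blocks; `b i` is the index of the block that contains `i`. -/
theorem exists_isFKLimit_blocks {x : ℕ → ℕ → X} (hC : IsFKCauchy x) :
    ∃ b : ℕ → ℕ, Monotone b ∧ (∀ n, b n ^ 2 ≤ n) ∧ IsFKLimit x fun i => x (b i) i := by
  have hpos : ∀ j : ℕ, (0 : ℝ) < 1 / (j + 1) := fun j => by positivity
  choose M hM using fun p j => eventually_atTop.1
    (eventually_gap_lt (lt_add_of_pos_right (FK (x p) (x j)) (hpos j)))
  obtain ⟨s, hs0, hsm, hsq, hsg, hsM⟩ := exists_fast_growing M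
  obtain ⟨b, hb⟩ := exists_block_index hs0 hsm
  have hbeq : ∀ i j, s j ≤ i → i < s (j + 1) → b i = j := fun i j h1 h2 => by
    have h3 := hsm.lt_iff_lt.1 ((hb i).1.trans_lt h2)
    have h4 := hsm.lt_iff_lt.1 (h1.trans_lt (hb i).2)
    omega
  refine ⟨b, fun i i' hii => ?_, fun n => (hsq _).trans (hb n).1, ?_⟩
  · have := hsm.lt_iff_lt.1 (((hb i).1.trans hii).trans_lt (hb i').2)
    omega
  refine Metric.tendsto_atTop.2 fun ε hε => ?_
  -- With `η = ε / 7`, late blocks have gaps at most `2 * η` (the distance, plus `1 / (j + 1)`);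
  -- two of them and the part before them give a gap of at most `5 * η`, so the limit is at
  -- distance at most `6 * η`.
  obtain ⟨N, hN⟩ := hC (ε / 7) (by positivity)
  refine ⟨N, fun p hp => ?_⟩
  rw [Real.dist_eq, sub_zero, abs_of_nonneg (FK_nonneg _ _)]
  suffices h : FK (x p) (fun i => x (b i) i) ≤ 6 * (ε / 7) by linarith
  obtain ⟨K, hK⟩ := exists_nat_one_div_lt (by positivity : 0 < ε / 7)
  have hgap : ∀ j n, p ≤ j → K ≤ j → 0 < j → s j ≤ n →
      gap n (6 * (ε / 7)) (x p) (x j) ≤ 2 * (ε / 7) := fun j n hpj hKj hj hn => by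
    have h1 : (1 : ℝ) / (j + 1) ≤ 1 / (K + 1) := by gcongr
    have h2 := hN p j hp (hp.trans hpj)
    have h3 := hM p j n ((hsM j p hpj hj).trans hn)
    exact (gap_anti (by linarith)).trans (h3.le.trans (by linarith))
  refine FK_le (by positivity) (lt_of_le_of_lt (fbar_le (c := 5 * (ε / 7)) ?_) (by linarith))
  filter_upwards [eventually_ge_atTop (s (p + K + 2))] with n hn
  have hbn : p + K + 2 < b n + 1 := hsm.lt_iff_lt.1 (hn.trans_lt (hb n).2)
  obtain ⟨i, hi⟩ : ∃ i, b n = i + 1 := ⟨b n - 1, by omega⟩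
  have hin : s (i + 1) ≤ n := hi ▸ (hb n).1
  have hn2 : n < s (i + 1 + 1) := hi ▸ (hb n).2
  have hii : s i < s (i + 1) := hsm (Nat.lt_succ_self i)
  have hn0 : 0 < n := by omega
  have h := gap_le_of_blocks (x := x p) (z := fun i => x (b i) i) (w := x (i + 1)) (w' := x i)
    (δ := 6 * (ε / 7)) (η := 2 * (ε / 7)) hii.le hin hn0
    (fun m h1 h2 => by simp only [hbeq m (i + 1) h1 (h2.trans hn2)])
    (fun m h1 h2 => by simp only [hbeq m i h1 h2])
    (hgap _ _ (by omega) (by omega) (by omega) hin)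
    (hgap _ _ (by omega) (by omega) (by omega) hii.le) (by positivity)
  have hlast : (s i : ℝ) / n ≤ ε / 7 := by
    have h1 : ((K : ℝ) + 1) * s i ≤ n := by
      have : (K + 1) * s i ≤ n :=
        (Nat.mul_le_mul_right _ (by omega)).trans ((hsg i).trans hin)
      exact_mod_cast this
    have hn' : (0 : ℝ) < n := by exact_mod_cast hn0
    refine le_trans ?_ hK.le
    rw [div_le_div_iff₀ hn' (by positivity)]
    linarith
  linarith

end Construction

end FeldmanKatok

theorem mainTheorem4 {X : Type*} [MetricSpace X] [CompactSpace X] [MeasurableSpace X]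
    [BorelSpace X] (T : X → X) (hT : Continuous T) (x : ℕ → X)
    (hx : ∀ p : ℕ, FeldmanKatok.IsErgodicPoint T (x p))
    (hC : FeldmanKatok.IsFKCauchy (fun p : ℕ => FeldmanKatok.trajectory T (x p))) :
    ∃ μ : ProbabilityMeasure X,
      Ergodic T (μ : Measure X) ∧
      (∀ ν : ℕ → ProbabilityMeasure X,
        (∀ p : ℕ, FeldmanKatok.IsGeneric (FeldmanKatok.trajectory T (x p)) (ν p)) →
          Tendsto ν atTop (𝓝 μ)) ∧
      (∃ z : ℕ → X,
        FeldmanKatok.IsQuasiOrbit T z ∧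
        FeldmanKatok.IsFKLimit (fun p : ℕ => FeldmanKatok.trajectory T (x p)) z ∧
        FeldmanKatok.IsGeneric z μ) ∧
      (∀ z : ℕ → X,
        FeldmanKatok.IsFKLimit (fun p : ℕ => FeldmanKatok.trajectory T (x p)) z →
          FeldmanKatok.IsGeneric z μ) := by
  choose ν herg hν using hx
  obtain ⟨μ, hμ⟩ := FeldmanKatok.exists_tendsto_of_isFKCauchy hν hC
  obtain ⟨b, hb, hbn, hz⟩ := FeldmanKatok.exists_isFKLimit_blocks hC
  refine ⟨μ, FeldmanKatok.ergodic_of_isFKCauchy hT hC hν herg hμ, fun ν' hν' => ?_,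
    ⟨_, FeldmanKatok.isQuasiOrbit_blocks hb hbn, hz, hz.isGeneric hν hμ⟩,
    fun z hz => hz.isGeneric hν hμ⟩
  rwa [funext fun p => (hν' p).unique (hν p)]
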